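/- Let $d,n\ge 0$ be integers and let $\Theta=(V,H)$ be a $(d+1)$-uniform hypergraph with vertex set $V=\{1,\dots,n\}$, i.e. $H$ is a set of $(d+1)$-element subsets of $V$. For a configuration $p=(p(1),\dots,p(n))\in(\mathbb{R}^d)^n=\mathbb{R}^{dn}$, let the $d$-volume measurement map be $$f_\Theta(p)=\left(\det\begin{bmatrix}1&\cdots&1\\ p(i_1)&\cdots&p(i_{d+1})\end{bmatrix}\right)_{\{i_1<\dots<i_{d+1}\}\in H},$$ and let $K=K_n^{d+1}$ be the complete $(d+1)$-uniform hypergraph on $V$, whose hyperedges are all the $(d+1)$-element subsets of $V$. The framework $(\Theta,p)$ is called $d$-volume rigid if there is $\varepsilon>0$ such that $$f_\Theta^{-1}(f_\Theta(p))\cap B_\varepsilon(p)=f_{K}^{-1}(f_{K}(p))\cap B_\varepsilon(p),$$ where $B_\varepsilon(p)$ is the open Euclidean ball of radius $\varepsilon$ about $p$ in $\mathbb{R}^{dn}$. The configuration $p$ (and the framework $(\Theta,p)$) is called generic if $g(p)\ne 0$ for every nonzero polynomial $g$ in $dn$ variables with rational coefficients. Then $d$-volume rigidity is a generic property of frameworks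 of $\Theta$: either $(\Theta,p)$ is $d$-volume rigid for every generic $p\in\mathbb{R}^{dn}$, or $(\Theta,p)$ is $d$-volume rigid for no generic $p\in\mathbb{R}^{dn}$. -/

import Mathlib

namespace VolumeRigidity

/-- A `k`-uniform hypergraph on the labelled vertex set `Fin n`: a set of hyperedges, each of which
is a set of exactly `k` vertices. -/
structure UniformHypergraph (n k : ℕ) where
  edges : Finset (Finset (Fin n))
  uniform : ∀ h ∈ edges, h.card = k

/-- The complete `k`-uniform hypergraph on `n` vertices. -/
def UniformHypergraph.complete (n k : ℕ) : UniformHypergraph n k where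
  edges := Finset.powersetCard k Finset.univ
  uniform := fun _ hh => (Finset.mem_powersetCard.mp hh).2

/-- A configuration of `n` points in `ℝ^d`, as a point of the Euclidean space `ℝ^(dn)`. The `k`-th
coordinate of the point at vertex `i` is `p (i, k)`. -/
abbrev Config (n d : ℕ) : Type := EuclideanSpace ℝ (Fin n × Fin d)

/-- The configuration matrix: the column of vertex `i` is `1` followed by the coordinates of the
point at `i`. -/
def configMatrix {n d : ℕ} (p : Config n d) : Matrix (Fin (d + 1)) (Fin n) ℝ :=
  Matrix.of fun r i => Fin.cases (1 : ℝ) (fun k : Fin d => p (i, k)) r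

/-- The square submatrix of the configuration matrix on the columns in `h`, taken in increasing
order of the vertices. -/
def edgeMatrix {n d : ℕ} (h : Finset (Fin n)) (hh : h.card = d + 1) (p : Config n d) :
    Matrix (Fin (d + 1)) (Fin (d + 1)) ℝ :=
  (configMatrix p).submatrix id (h.orderEmbOfFin hh)

/-- The `d`-volume measurement map: it lists the signed volumes (the determinants) of all the
hyperedges. -/
def measurementMap {n d : ℕ} (Θ : UniformHypergraph n (d + 1)) (p : Config n d) :
    {h // h ∈ Θ.edges} → ℝ :=
  fun h => (edgeMatrix h.1 (Θ.uniform h.1 h.2) p).det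

/-- The framework `(Θ, p)` is `d`-volume rigid: near `p`, the configurations equivalent to `p` are
exactly the ones congruent to `p`. -/
def IsRigid {n d : ℕ} (Θ : UniformHypergraph n (d + 1)) (p : Config n d) : Prop :=
  ∃ ε : ℝ, 0 < ε ∧
    measurementMap Θ ⁻¹' {measurementMap Θ p} ∩ Metric.ball p ε =
      measurementMap (UniformHypergraph.complete n (d + 1)) ⁻¹'
        {measurementMap (UniformHypergraph.complete n (d + 1)) p} ∩ Metric.ball p ε

/-- A configuration is generic if no nonzero polynomial with rational coefficients vanishes
at it. -/
def IsGeneric {n d : ℕ} (p : Config n d) : Prop :=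
  ∀ f : MvPolynomial (Fin n × Fin d) ℚ, f ≠ 0 → MvPolynomial.aeval (fun ik => p ik) f ≠ 0

/-- A property of configurations is generic if it holds at all generic configurations or at none
of them. -/
def IsGenericProperty {n d : ℕ} (P : Config n d → Prop) : Prop :=
  (∀ p, IsGeneric p → P p) ∨ (∀ p, IsGeneric p → ¬ P p)

end VolumeRigidity

open Filter Topology MvPolynomial

namespace VolumeRigidity

/-! Rigidity is decided by linear algebra over the field of rational functions, with no reference to
`p`. The measurements are rational polynomials; choose edges of Θ whose gradients form a basis of
the span of all gradients of Θ. Evaluation at a generic `p` is injective on polynomials, so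
independence survives it, and the map F of chosen measurements is a submersion at `p`.

If every edge gradient of K lies in that span, the measurements of K are locally constant on the
fibre of F (`eventually_polyMap_eq`), and every generic framework is rigid. Otherwise some edge of K
has an independent gradient; adjoining it to F still gives a submersion, so its volume varies on the
fibre of F arbitrarily near `p` (`frequently_polyMap_eq_and_ne`). Near `p` that fibre is the fibre
of Θ, so no generic framework is rigid. -/

/-- If the differential of `f` vanishes on the kernel of the differential of `g` near a point `p`
at which `g` is a submersion, then `f` is locally constant on the fibre of `g` through `p`. -/
theorem eventually_eq_of_ker_fderiv_le {E F G : Type*}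
    [NormedAddCommGroup E] [NormedSpace ℝ E] [CompleteSpace E]
    [NormedAddCommGroup F] [NormedSpace ℝ F] [NormedAddCommGroup G] [NormedSpace ℝ G]
    {g : E → F} {f : E → G} (hg : ContDiff ℝ 1 g) (hf : Differentiable ℝ f) {p : E}
    {R : F →L[ℝ] E} (hR : ∀ y, fderiv ℝ g p (R y) = y)
    (hker : ∀ᶠ q in 𝓝 p, ∀ v, fderiv ℝ g q v = 0 → fderiv ℝ f q v = 0) :
    ∀ᶠ q in 𝓝 p, g q = g p → f q = f p := by
  set L := fderiv ℝ g p with hL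
  -- `Ψ` straightens the fibres of `g`: it has derivative `id` at `p`, and `L ∘ Ψ = g`.
  let Ψ : E → E := fun x => x - R (L x) + R (g x)
  have hLΨ : ∀ x, L (Ψ x) = g x := fun x => by simp [Ψ, hR]
  have hΨ : ContDiff ℝ 1 Ψ := by fun_prop
  have hgd : ∀ x, HasFDerivAt g (fderiv ℝ g x) x := fun x =>
    (hg.differentiable one_ne_zero x).hasFDerivAt
  have hΨ' : HasFDerivAt Ψ ((ContinuousLinearEquiv.refl ℝ E : E ≃L[ℝ] E) : E →L[ℝ] E) p := by
    have h := ((hasFDerivAt_id (𝕜 := ℝ) p).sub (R.comp L).hasFDerivAt).add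
      (R.hasFDerivAt.comp p (hgd p))
    refine HasFDerivAt.congr_fderiv (f := Ψ) h ?_
    ext v
    simp [← hL]
  let e := hΨ.contDiffAt.toOpenPartialHomeomorph Ψ hΨ' one_ne_zero
  have hes : p ∈ e.source := hΨ.contDiffAt.mem_toOpenPartialHomeomorph_source hΨ' one_ne_zero
  have het : Ψ p ∈ e.target :=
    hΨ.contDiffAt.image_mem_toOpenPartialHomeomorph_target hΨ' one_ne_zero
  have heΨ : ∀ x, e x = Ψ x := fun x => rfl
  have hep : e.symm (Ψ p) = p := e.left_inv hes
  have hsymm : ContDiffAt ℝ 1 e.symm (Ψ p) := hΨ.contDiffAt.to_localInverse hΨ' one_ne_zero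
  have hgood : ∀ᶠ y in 𝓝 (Ψ p), y ∈ e.target ∧ DifferentiableAt ℝ e.symm y ∧
      ∀ v, fderiv ℝ g (e.symm y) v = 0 → fderiv ℝ f (e.symm y) v = 0 := by
    refine (e.open_target.eventually_mem het).and (Eventually.and ?_ ?_)
    · exact (hsymm.eventually (by simp)).mono fun y hy => hy.differentiableAt one_ne_zero
    · have := e.continuousAt_symm het
      rw [ContinuousAt, hep] at this
      exact this.eventually hker
  obtain ⟨r, hr, hball⟩ := Metric.eventually_nhds_iff_ball.mp hgood
  have hnear : ∀ᶠ q in 𝓝 p, q ∈ e.source ∧ Ψ q ∈ Metric.ball (Ψ p) r :=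
    (e.open_source.eventually_mem hes).and
      (hΨ.continuous.continuousAt.eventually (Metric.ball_mem_nhds _ hr))
  filter_upwards [hnear] with q hq hgq
  -- The segment from `Ψ p` to `Ψ q` runs in a direction of `ker L`; its preimage under `Ψ` is a
  -- path along which `f` has zero derivative.
  have hLw : L (Ψ q - Ψ p) = 0 := by rw [map_sub, hLΨ, hLΨ, hgq, sub_self]
  have hderiv : ∀ t ∈ Set.Icc (0 : ℝ) 1,
      HasDerivAt (fun t : ℝ => f (e.symm (Ψ p + t • (Ψ q - Ψ p)))) 0 t := by
    intro t ht
    have hy : Ψ p + t • (Ψ q - Ψ p) ∈ Metric.ball (Ψ p) r :=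
      (convex_ball (Ψ p) r).add_smul_sub_mem (Metric.mem_ball_self hr) hq.2 ht
    set y := Ψ p + t • (Ψ q - Ψ p) with hydef
    obtain ⟨hyt, hyd, hyk⟩ := hball y hy
    have hline : HasDerivAt (fun t : ℝ => Ψ p + t • (Ψ q - Ψ p)) (Ψ q - Ψ p) t := by
      simpa using ((hasDerivAt_id t).smul_const (Ψ q - Ψ p)).const_add (Ψ p)
    -- In the straightened coordinates `g` is the linear map `L`, so its derivative is `L` at every
    -- `y`, not only at `Ψ p`.
    have hgL : HasFDerivAt (fun z => g (e.symm z)) L y := by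
      refine L.hasFDerivAt.congr_of_eventuallyEq ?_
      filter_upwards [e.open_target.mem_nhds hyt] with z hz
      rw [← hLΨ, ← heΨ, e.right_inv hz]
    have hgc := (hgd (e.symm y)).comp y hyd.hasFDerivAt
    have hkill : fderiv ℝ g (e.symm y) (fderiv ℝ e.symm y (Ψ q - Ψ p)) = 0 := by
      rw [← hLw, hgL.unique hgc]; rfl
    have hfc := ((hf (e.symm y)).hasFDerivAt.comp y hyd.hasFDerivAt).comp_hasDerivAt t hline
    have h0 := hyk _ hkill
    exact hfc.congr_deriv h0
  have hconst := constant_of_has_deriv_right_zero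
    (fun t ht => (hderiv t ht).continuousAt.continuousWithinAt)
    (fun t ht => (hderiv t (Set.Ico_subset_Icc_self ht)).hasDerivWithinAt) 1
    (Set.right_mem_Icc.mpr zero_le_one)
  simpa [← heΨ, e.left_inv hq.1, e.left_inv hes] using hconst

/-! ### Polynomial maps at generic points -/

section Polynomial

variable {σ : Type*} [Fintype σ]

/-- The differential of a polynomial function is given by the partial derivatives. -/
theorem hasFDerivAt_aeval (f : MvPolynomial σ ℚ) (p : EuclideanSpace ℝ σ) :
    HasFDerivAt (fun q : EuclideanSpace ℝ σ => aeval (fun i => q i) f)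
      (∑ i, aeval (fun i => p i) (pderiv i f) • EuclideanSpace.proj (𝕜 := ℝ) i) p := by
  classical
  induction f using MvPolynomial.induction_on with
  | C a => simpa using hasFDerivAt_const (algebraMap ℚ ℝ a) p
  | add f g hf hg =>
    simp only [map_add, add_smul, Finset.sum_add_distrib]
    exact hf.add hg
  | mul_X f j hf =>
    have hj : HasFDerivAt (fun q : EuclideanSpace ℝ σ => q j)
      (EuclideanSpace.proj (𝕜 := ℝ) j : EuclideanSpace ℝ σ →L[ℝ] ℝ) p :=
      (EuclideanSpace.proj (𝕜 := ℝ) j : EuclideanSpace ℝ σ →L[ℝ] ℝ).hasFDerivAt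
    have h := hf.mul hj
    simp only [map_mul, aeval_X]
    refine HasFDerivAt.congr_fderiv h ?_
    ext v
    simp [Derivation.leibniz, pderiv_X, Pi.single_apply, add_mul, Finset.sum_add_distrib,
      Finset.mul_sum, mul_assoc, apply_ite]

theorem contDiff_aeval (f : MvPolynomial σ ℚ) (n : WithTop ℕ∞) :
    ContDiff ℝ n (fun q : EuclideanSpace ℝ σ => aeval (fun i => q i) f) := by
  induction f using MvPolynomial.induction_on with
  | C a => simpa using contDiff_const
  | add f g hf hg => simpa using hf.add hg
  | mul_X f j hf =>
    simp only [map_mul, aeval_X]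
    exact hf.mul (by fun_prop)

/-- The polynomial map given by a family of polynomials. -/
noncomputable def polyMap {κ : Type*} (F : κ → MvPolynomial σ ℚ) (q : EuclideanSpace ℝ σ) :
    κ → ℝ :=
  fun s => aeval (fun i => q i) (F s)

theorem contDiff_polyMap {κ : Type*} [Fintype κ] (F : κ → MvPolynomial σ ℚ) (n : WithTop ℕ∞) :
    ContDiff ℝ n (polyMap F) :=
  contDiff_pi.mpr fun s => contDiff_aeval (F s) n

theorem fderiv_polyMap_apply {κ : Type*} [Fintype κ] (F : κ → MvPolynomial σ ℚ)
    (q v : EuclideanSpace ℝ σ) (s : κ) :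
    fderiv ℝ (polyMap F) q v s = ∑ i, aeval (fun i => q i) (pderiv i (F s)) * v i := by
  have h : HasFDerivAt (polyMap F) (ContinuousLinearMap.pi fun s =>
      ∑ i, aeval (fun i => q i) (pderiv i (F s)) • EuclideanSpace.proj (𝕜 := ℝ) i) q :=
    hasFDerivAt_pi.mpr fun s => hasFDerivAt_aeval (F s) q
  simp [h.fderiv]

/-- The gradient of a polynomial, as a vector over the field of rational functions. -/
noncomputable def grad (f : MvPolynomial σ ℚ) : σ → FractionRing (MvPolynomial σ ℚ) :=
  fun i => algebraMap _ _ (pderiv i f)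

/-- Linearly independent rows over a field have a right inverse matrix. -/
theorem exists_right_inverse_of_linearIndependent {K κ : Type*} [Field K] [Fintype κ]
    [DecidableEq κ] {A : Matrix κ σ K} (hA : LinearIndependent K A) :
    ∃ B : Matrix σ κ K, A * B = 1 := by
  classical
  have hinj : Function.Injective (Matrix.toLin' A.transpose) := by
    have := Matrix.vecMul_injective_iff.mpr hA
    intro x y hxy
    exact this (by simpa [Matrix.toLin'_apply, Matrix.mulVec_transpose] using hxy)
  obtain ⟨g, hg⟩ := LinearMap.exists_leftInverse_of_injective _ (LinearMap.ker_eq_bot.mpr hinj)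
  refine ⟨(LinearMap.toMatrix' g).transpose, ?_⟩
  have h := congrArg LinearMap.toMatrix' hg
  rw [LinearMap.toMatrix'_comp, LinearMap.toMatrix'_toLin', LinearMap.toMatrix'_id] at h
  rw [← Matrix.transpose_inj, Matrix.transpose_mul, Matrix.transpose_transpose, h,
    Matrix.transpose_one]

/-- At a point that annihilates no nonzero polynomial, a polynomial map with linearly independent
gradients is a submersion. -/
theorem exists_right_inverse_fderiv_polyMap {κ : Type*} [Fintype κ]
    {F : κ → MvPolynomial σ ℚ}
    (hF : LinearIndependent (FractionRing (MvPolynomial σ ℚ)) fun s => grad (F s))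
    {p : EuclideanSpace ℝ σ}
    (hp : ∀ f : MvPolynomial σ ℚ, f ≠ 0 → aeval (fun i => p i) f ≠ 0) :
    ∃ R : (κ → ℝ) →L[ℝ] EuclideanSpace ℝ σ, ∀ y, fderiv ℝ (polyMap F) p (R y) = y := by
  classical
  have hinj : Function.Injective (aeval (fun i => p i) : MvPolynomial σ ℚ →ₐ[ℚ] ℝ).toRingHom :=
    (injective_iff_map_eq_zero _).mpr fun f hf => by_contra fun h => hp f h hf
  -- Genericity extends evaluation at `p` to rational functions, which carries the right inverse `B`
  -- to a real matrix.
  let φ : FractionRing (MvPolynomial σ ℚ) →+* ℝ := IsFractionRing.lift hinj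
  have hφ : ∀ f : MvPolynomial σ ℚ, φ (algebraMap _ _ f) = aeval (fun i => p i) f :=
    fun f => IsFractionRing.lift_algebraMap hinj f
  obtain ⟨B, hB⟩ := exists_right_inverse_of_linearIndependent (A := Matrix.of fun s => grad (F s)) hF
  refine ⟨(EuclideanSpace.equiv σ ℝ).symm.toContinuousLinearMap.comp
    (LinearMap.toContinuousLinearMap (Matrix.toLin' (B.map φ))), fun y => ?_⟩
  ext s
  have hmul : (Matrix.of fun s i => aeval (fun i => p i) (pderiv i (F s))) * B.map φ = 1 := by
    ext s t
    have h := congrArg φ (congrFun (congrFun hB s) t)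
    rw [Matrix.mul_apply, map_sum] at h
    simp only [map_mul, Matrix.of_apply, grad, hφ, Matrix.one_apply, apply_ite φ, map_one, map_zero] at h
    rw [Matrix.mul_apply, Matrix.one_apply, ← h]
    rfl
  have h := congrFun (congrArg (fun M : Matrix κ κ ℝ => M.mulVec y) hmul) s
  simp only [← Matrix.mulVec_mulVec, Matrix.one_mulVec] at h
  rw [fderiv_polyMap_apply, ← h]
  rfl

/-- A linear dependence of gradients over the field of rational functions specializes to nearly
every point. -/
theorem eventually_ker_fderiv_polyMap_le {κ ι : Type*} [Fintype κ] [Fintype ι]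
    {F : κ → MvPolynomial σ ℚ} {G : ι → MvPolynomial σ ℚ}
    (hspan : ∀ e, grad (G e) ∈
      Submodule.span (FractionRing (MvPolynomial σ ℚ)) (Set.range fun s => grad (F s)))
    {p : EuclideanSpace ℝ σ}
    (hp : ∀ f : MvPolynomial σ ℚ, f ≠ 0 → aeval (fun i => p i) f ≠ 0) :
    ∀ᶠ q in 𝓝 p, ∀ v, fderiv ℝ (polyMap F) q v = 0 → fderiv ℝ (polyMap G) q v = 0 := by
  have key : ∀ e, ∀ᶠ q in 𝓝 p, ∀ v, fderiv ℝ (polyMap F) q v = 0 →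
      fderiv ℝ (polyMap G) q v e = 0 := by
    intro e
    obtain ⟨c, hc⟩ := (Submodule.mem_span_range_iff_exists_fun _).mp (hspan e)
    -- The common denominator `b` is nonzero at `p` by genericity, hence also at nearby `q`, which
    -- need not be generic.
    obtain ⟨b, hb⟩ := IsLocalization.exist_integer_multiples_of_finite
      (nonZeroDivisors (MvPolynomial σ ℚ)) c
    choose a ha using hb
    have hrel : ∀ i, (b : MvPolynomial σ ℚ) * pderiv i (G e) = ∑ s, a s * pderiv i (F s) := by
      intro i
      apply IsFractionRing.injective (MvPolynomial σ ℚ) (FractionRing (MvPolynomial σ ℚ))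
      have hi := congrFun hc i
      simp only [Finset.sum_apply, Pi.smul_apply, smul_eq_mul, grad] at hi
      simp only [map_mul, map_sum, ha, ← hi, Finset.mul_sum, Algebra.smul_def, mul_assoc]
    have hb0 : aeval (fun i => p i) (b : MvPolynomial σ ℚ) ≠ 0 :=
      hp _ (nonZeroDivisors.ne_zero b.2)
    filter_upwards [(contDiff_aeval (b : MvPolynomial σ ℚ) 0).continuous.continuousAt.eventually_ne
      hb0] with q hq v hv
    have hs : ∀ s, ∑ i, aeval (fun i => q i) (pderiv i (F s)) * v i = 0 := fun s => by
      rw [← fderiv_polyMap_apply, hv, Pi.zero_apply]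
    rw [fderiv_polyMap_apply]
    refine (mul_eq_zero.mp ?_).resolve_left hq
    calc aeval (fun i => q i) (b : MvPolynomial σ ℚ) *
          ∑ i, aeval (fun i => q i) (pderiv i (G e)) * v i
        = ∑ i, aeval (fun i => q i) ((b : MvPolynomial σ ℚ) * pderiv i (G e)) * v i := by
          simp only [Finset.mul_sum, map_mul, mul_assoc]
      _ = ∑ s, aeval (fun i => q i) (a s) *
            ∑ i, aeval (fun i => q i) (pderiv i (F s)) * v i := by
          simp only [hrel, map_sum, map_mul, Finset.sum_mul, Finset.mul_sum, mul_assoc]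
          exact Finset.sum_comm
      _ = 0 := by simp [hs]
  filter_upwards [eventually_all.mpr key] with q hq v hv
  ext e
  exact hq e v hv

/-- Polynomials whose gradients lie in the span of linearly independent gradients are, near a point
annihilating no nonzero polynomial, constant on the fibre. -/
theorem eventually_polyMap_eq {κ ι : Type*} [Fintype κ] [Fintype ι]
    {F : κ → MvPolynomial σ ℚ} {G : ι → MvPolynomial σ ℚ}
    (hF : LinearIndependent (FractionRing (MvPolynomial σ ℚ)) fun s => grad (F s))
    (hspan : ∀ e, grad (G e) ∈
      Submodule.span (FractionRing (MvPolynomial σ ℚ)) (Set.range fun s => grad (F s)))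
    {p : EuclideanSpace ℝ σ}
    (hp : ∀ f : MvPolynomial σ ℚ, f ≠ 0 → aeval (fun i => p i) f ≠ 0) :
    ∀ᶠ q in 𝓝 p, polyMap F q = polyMap F p → polyMap G q = polyMap G p := by
  obtain ⟨R, hR⟩ := exists_right_inverse_fderiv_polyMap hF hp
  exact eventually_eq_of_ker_fderiv_le (contDiff_polyMap F 1)
    ((contDiff_polyMap G 1).differentiable one_ne_zero) hR
    (eventually_ker_fderiv_polyMap_le hspan hp)

/-- A polynomial whose gradient is independent of linearly independent gradients takes, arbitrarily
near a point annihilating no nonzero polynomial, a different value on the fibre. -/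
theorem frequently_polyMap_eq_and_ne {κ : Type*} [Fintype κ]
    {F : κ → MvPolynomial σ ℚ} {g : MvPolynomial σ ℚ}
    (hF : LinearIndependent (FractionRing (MvPolynomial σ ℚ)) fun s => grad (F s))
    (hg : grad g ∉
      Submodule.span (FractionRing (MvPolynomial σ ℚ)) (Set.range fun s => grad (F s)))
    {p : EuclideanSpace ℝ σ}
    (hp : ∀ f : MvPolynomial σ ℚ, f ≠ 0 → aeval (fun i => p i) f ≠ 0) :
    ∃ᶠ q in 𝓝 p, polyMap F q = polyMap F p ∧
      aeval (fun i => q i) g ≠ aeval (fun i => p i) g := by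
  let F' : Option κ → MvPolynomial σ ℚ := fun o => o.elim g F
  have hF' : LinearIndependent (FractionRing (MvPolynomial σ ℚ)) fun o => grad (F' o) :=
    linearIndependent_option.mpr ⟨hF, hg⟩
  obtain ⟨R, hR⟩ := exists_right_inverse_fderiv_polyMap hF' hp
  have hmap : map (polyMap F') (𝓝 p) = 𝓝 (polyMap F' p) :=
    ((contDiff_polyMap F' 1).contDiffAt.hasStrictFDerivAt one_ne_zero).map_nhds_eq_of_surj
      (LinearMap.range_eq_top.mpr fun y => ⟨R y, hR y⟩)
  -- If `g` were constant on the nearby fibre, the `none` coordinate would be determined by the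
  -- others on a neighbourhood of the image point; moving along that coordinate alone contradicts
  -- this.
  intro hev
  have hev' : ∀ᶠ y in 𝓝 (polyMap F' p),
      (∀ s, y (some s) = polyMap F' p (some s)) → y none = polyMap F' p none := by
    rw [← hmap, eventually_map]
    filter_upwards [hev] with q hq h
    by_contra hne
    exact hq ⟨funext h, hne⟩
  classical
  have htend : Tendsto (fun t : ℝ => polyMap F' p + t • Pi.single none (1 : ℝ)) (𝓝[≠] 0)
      (𝓝 (polyMap F' p)) := by
    have hc : Continuous fun t : ℝ =>
        polyMap F' p + t • (Pi.single none (1 : ℝ) : Option κ → ℝ) := by fun_prop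
    have := hc.tendsto 0
    rw [zero_smul, add_zero] at this
    exact this.mono_left nhdsWithin_le_nhds
  obtain ⟨t, ht, ht0⟩ := ((htend.eventually hev').and self_mem_nhdsWithin).exists
  have := ht fun s => by simp
  exact ht0 (by simpa using this)

end Polynomial

/-! ### Volume measurements as polynomials -/

/-- The determinant of an edge as a polynomial in the coordinates of the configuration. -/
noncomputable def edgePoly {n d : ℕ} (h : Finset (Fin n)) (hh : h.card = d + 1) :
    MvPolynomial (Fin n × Fin d) ℚ :=
  (Matrix.of fun (r c : Fin (d + 1)) => Fin.cases (motive := fun _ => MvPolynomial _ ℚ) 1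
    (fun k : Fin d => X (h.orderEmbOfFin hh c, k)) r).det

theorem aeval_edgePoly {n d : ℕ} (h : Finset (Fin n)) (hh : h.card = d + 1) (p : Config n d) :
    aeval (fun ik => p ik) (edgePoly h hh) = (edgeMatrix h hh p).det := by
  rw [edgePoly, AlgHom.map_det]
  congr 1
  ext r c
  refine Fin.cases ?_ (fun k => ?_) r <;> simp [edgeMatrix, configMatrix]

/-- The family of edge polynomials of a hypergraph. -/
noncomputable def edgePolys {n d : ℕ} (Θ : UniformHypergraph n (d + 1)) :
    {h // h ∈ Θ.edges} → MvPolynomial (Fin n × Fin d) ℚ :=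
  fun h => edgePoly h.1 (Θ.uniform h.1 h.2)

theorem measurementMap_eq_polyMap {n d : ℕ} (Θ : UniformHypergraph n (d + 1)) :
    measurementMap Θ = polyMap (edgePolys Θ) := by
  funext p h
  exact (aeval_edgePoly _ _ _).symm

theorem measurementMap_eq_of_complete {n d : ℕ} (Θ : UniformHypergraph n (d + 1))
    {p q : Config n d}
    (h : measurementMap (UniformHypergraph.complete n (d + 1)) q =
      measurementMap (UniformHypergraph.complete n (d + 1)) p) :
    measurementMap Θ q = measurementMap Θ p :=
  funext fun e => congrFun h
    ⟨e.1, Finset.mem_powersetCard.mpr ⟨Finset.subset_univ _, Θ.uniform e.1 e.2⟩⟩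

/-- Only one inclusion has content: every edge of `Θ` is an edge of the complete hypergraph, so the
other always holds. -/
theorem isRigid_iff_eventually {n d : ℕ} (Θ : UniformHypergraph n (d + 1)) (p : Config n d) :
    IsRigid Θ p ↔ ∀ᶠ q in 𝓝 p, measurementMap Θ q = measurementMap Θ p →
      measurementMap (UniformHypergraph.complete n (d + 1)) q =
        measurementMap (UniformHypergraph.complete n (d + 1)) p := by
  rw [Metric.eventually_nhds_iff_ball]
  refine exists_congr fun ε => and_congr_right fun _ => ⟨fun h q hq hΘ => ?_, fun h => ?_⟩
  · exact (h.subset ⟨hΘ, hq⟩).1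
  · ext q
    exact ⟨fun hq => ⟨h q hq.2 hq.1, hq.2⟩,
      fun hq => ⟨measurementMap_eq_of_complete Θ hq.1, hq.2⟩⟩

end VolumeRigidity

theorem mainTheorem9 (n d : ℕ) (Θ : VolumeRigidity.UniformHypergraph n (d + 1)) :
    VolumeRigidity.IsGenericProperty
      (fun p : VolumeRigidity.Config n d => VolumeRigidity.IsRigid Θ p) := by
  open VolumeRigidity in
  obtain ⟨κ, a, ha, hspan, hli⟩ := exists_linearIndependent'
    (FractionRing (MvPolynomial (Fin n × Fin d) ℚ)) fun e => grad (edgePolys Θ e)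
  have : Finite κ := Finite.of_injective a ha
  have : Fintype κ := Fintype.ofFinite κ
  have hfibre : ∀ p q : Config n d, measurementMap Θ q = measurementMap Θ p →
      polyMap (edgePolys Θ ∘ a) q = polyMap (edgePolys Θ ∘ a) p := fun p q h => by
    rw [measurementMap_eq_polyMap] at h
    exact funext fun s => congrFun h (a s)
  by_cases hall : ∀ e, grad (edgePolys (UniformHypergraph.complete n (d + 1)) e) ∈
      Submodule.span (FractionRing (MvPolynomial (Fin n × Fin d) ℚ))
        (Set.range fun s => grad ((edgePolys Θ ∘ a) s))
  · refine Or.inl fun p hp => (isRigid_iff_eventually Θ p).mpr ?_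
    filter_upwards [eventually_polyMap_eq hli hall hp] with q hq h
    rw [measurementMap_eq_polyMap (UniformHypergraph.complete n (d + 1))]
    exact hq (hfibre p q h)
  · push Not at hall
    obtain ⟨e, he⟩ := hall
    refine Or.inr fun p hp hrigid => ?_
    -- The gradients of `Θ` itself lie in the span, so near `p` the chosen edges already determine
    -- all its measurements.
    have hΘ : ∀ᶠ q in 𝓝 p, polyMap (edgePolys Θ ∘ a) q = polyMap (edgePolys Θ ∘ a) p →
        polyMap (edgePolys Θ) q = polyMap (edgePolys Θ) p :=
      eventually_polyMap_eq hli
        (fun e => hspan.symm ▸ Submodule.subset_span (Set.mem_range_self e)) hp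
    refine frequently_polyMap_eq_and_ne hli he hp ?_
    filter_upwards [hΘ, (isRigid_iff_eventually Θ p).mp hrigid] with q h₁ h₂ hq
    simp only [measurementMap_eq_polyMap] at h₂
    exact hq.2 (congrFun (h₂ (h₁ hq.1)) e)
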